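/- Let $V$ be a finite set. Let $G_0$ be either a directed graph on $V$ without multiple edges (loops are allowed; they can be excluded by taking $G_0$ loopless and putting all loops into $\mathcal F$ below) or an undirected simple graph on $V$. Write $uv$ for the edge from $u$ to $v$ (in the undirected case $uv=vu$), and let $\mathcal F$ be an arbitrary set of possible edges. Let $\mathcal G$ be the set of all graphs $G$ on $V$ of the same kind (directed, or undirected simple) with the same degree sequence as $G_0$ (in- and out-degree of every vertex in the directed case, degree of every vertex in the undirected case) and with $E(G)\cap\mathcal F=E(G_0)\cap\mathcal F$. Let $\tilde{\mathcal F}$ be the set of pairs $uv$ that are edges of every $G\in\mathcal G$ or of no $G\in\mathcal G$. For a graph $G$ on $V$ of this kind and $u\in V$ put $$N_G(u)=\{v\in V: vu\in E(G),\ vu\notin\tilde{\mathcal F}\},\qquad M_G(u)=\{v\in V: uv\notin E(G),\ uv\notin\tilde{\mathcal F}\}.$$ One iteration of the Unweighted Graph Sampler started from $G\in\mathcal G$ is the following. If $N_G(v)=\emptyset$ for all $v\in V$, return $G$. Otherwise set $W_{-1}=*$ (a symbol that is not a vertex), draw $W_0$ uniformly from $\{v\in V:N_G(v)\ne\emptyset\}$,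 set $n=0$, and repeat: draw $W_{n+1}$ uniformly from $N_G(W_n)\setminus\{W_{n-1}\}$; draw $W_{n+2}$ uniformly from $M_G(W_{n+1})$; remove the edge $W_{n+1}W_n$ from $G$ and add the edge $W_{n+1}W_{n+2}$; increase $n$ by $2$; until $W_n=W_0$. Then return the current graph $G$. For $G,H\in\mathcal G$ let $Q(G,H)$ be the probability that one iteration started from $G$ terminates and returns $H$. Then the Markov chain with transition matrix $Q$ is ergodic with respect to the uniform distribution $\pi$ on $\mathcal G$, in the following sense: $Q$ is a stochastic matrix on $\mathcal G$ (so an iteration almost surely terminates and returns an element of $\mathcal G$), $\pi$ is stationary for $Q$, $Q$ is irreducible, and for every initial state $G\in\mathcal G$ and every $H\in\mathcal G$, $$\lim_{n\to\infty}\frac1n\sum_{k=0}^{n-1}Q^k(G,H)=\pi(H)=\frac1{|\mathcal G|}.$$ -/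

import Mathlib

open scoped ENNReal

/-! ### Ergodic finite Markov chains -/

/-- The finite Markov chain with transition matrix `P` on `S` is *ergodic with respect to* `π`:
`P` is a transition matrix, `π` is a stationary probability distribution, the chain is irreducible
(every state is reached from every state with positive probability), and, whatever the initial
state `x`, the time averages `n⁻¹ ∑_{k < n} Pᵏ(x, ·)` converge to `π`.
(Aperiodicity is not part of this notion.) -/
structure IsErgodicChain {S : Type*} [Fintype S] [DecidableEq S] (P : Matrix S S ℝ) (π : S → ℝ) :
    Prop where
  stochastic : P ∈ Matrix.rowStochastic ℝ S
  prob : π ∈ stdSimplex ℝ S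
  stationary : Matrix.vecMul π P = π
  irreducible : P.IsIrreducible
  average : ∀ x y : S, Filter.Tendsto
    (fun n : ℕ => (n : ℝ)⁻¹ * ∑ k ∈ Finset.range n, (P ^ k) x y) Filter.atTop (nhds (π y))

/-- The uniform distribution on a finite set. -/
noncomputable def uniformDist (S : Type*) [Fintype S] : S → ℝ := fun _ => (Fintype.card S : ℝ)⁻¹

/-! ### Graphs on a fixed vertex set whose edges can be edited

The algorithm is the same for directed and for undirected graphs; the two instances below are the
only ones used. -/

/-- A type `X` of graphs on the vertex set `V`, with the operations `E(G) ∖ {uv}`, `E(G) ∪ {uv}`. -/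
class EditableGraph (X : Type*) (V : outParam Type*) where
  /-- `uv ∈ E(G)` -/
  HasEdge : X → V → V → Prop
  /-- `E(G) ∖ {uv}` -/
  removeEdge : X → V → V → X
  /-- `E(G) ∪ {uv}` -/
  addEdge : X → V → V → X

/-- Directed graphs without multiple edges (loops are allowed). -/
instance instEditableDigraph (V : Type*) : EditableGraph (Digraph V) V where
  HasEdge G u v := G.Adj u v
  removeEdge G u v := ⟨fun a b => G.Adj a b ∧ ¬(a = u ∧ b = v)⟩
  addEdge G u v := ⟨fun a b => G.Adj a b ∨ (a = u ∧ b = v)⟩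

/-- Undirected simple graphs. -/
instance instEditableSimpleGraph (V : Type*) : EditableGraph (SimpleGraph V) V where
  HasEdge G u v := G.Adj u v
  removeEdge G u v := G.deleteEdges {s(u, v)}
  addEdge G u v := G ⊔ SimpleGraph.edge u v

/-! ### The state spaces -/

/-- The edge set of a digraph. -/
def Digraph.edges {V : Type*} (G : Digraph V) : Set (V × V) := {e | G.Adj e.1 e.2}

/-- The number of edges of `G` that end in `v`. -/
noncomputable def Digraph.inDeg {V : Type*} (G : Digraph V) (v : V) : ℕ :=
  {u | G.Adj u v}.ncard

/-- The number of edges of `G` that start in `v`. -/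
noncomputable def Digraph.outDeg {V : Type*} (G : Digraph V) (v : V) : ℕ :=
  {u | G.Adj v u}.ncard

/-- The digraphs with the in- and out-degrees of `G₀` that agree with `G₀` on `F`. -/
def directedClass {V : Type*} (G₀ : Digraph V) (F : Set (V × V)) : Set (Digraph V) :=
  {G | (∀ v, G.inDeg v = G₀.inDeg v ∧ G.outDeg v = G₀.outDeg v) ∧ G.edges ∩ F = G₀.edges ∩ F}

open Classical in
/-- The simple graphs with the degrees of `G₀` that agree with `G₀` on `F`. -/
def undirectedClass {V : Type*} [Fintype V] (G₀ : SimpleGraph V) (F : Set (Sym2 V)) :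
    Set (SimpleGraph V) :=
  {G | (∀ v, G.degree v = G₀.degree v) ∧ G.edgeSet ∩ F = G₀.edgeSet ∩ F}

/-! ### One iteration of the sampler -/

namespace UGS

open EditableGraph

/-- The probability of the point `b` under the uniform distribution on `s`
(the zero measure if `s` is empty: nothing can then be sampled). -/
noncomputable def unif {β : Type*} [DecidableEq β] (s : Finset β) (b : β) : ℝ≥0∞ :=
  if b ∈ s then (s.card : ℝ≥0∞)⁻¹ else 0

section

variable {V X : Type*} [Fintype V] [EditableGraph X V]

/-- `uv` is known: it is an edge of all the graphs in `𝒢`, or of none of them. -/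
def Known (𝒢 : Set X) (u v : V) : Prop :=
  (∀ G ∈ 𝒢, HasEdge G u v) ∨ (∀ G ∈ 𝒢, ¬ HasEdge G u v)

open Classical in
/-- `N_G(u)`: the vertices `v` such that `vu` is an edge of `G` and is not known. -/
noncomputable def inNbrs (𝒢 : Set X) (G : X) (u : V) : Finset V :=
  {v | HasEdge G v u ∧ ¬ Known 𝒢 v u}

open Classical in
/-- `M_G(u)`: the vertices `v` such that `uv` is not an edge of `G` and is not known. -/
noncomputable def nonOutNbrs (𝒢 : Set X) (G : X) (u : V) : Finset V :=
  {v | ¬ HasEdge G u v ∧ ¬ Known 𝒢 u v}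

open Classical in
/-- `N_G(w) ∖ {p}`, where `p = none` stands for the symbol `*`, which is not a vertex. -/
noncomputable def inNbrsAvoid (𝒢 : Set X) (G : X) (p : Option V) (w : V) : Finset V :=
  {v ∈ inNbrs 𝒢 G w | some v ≠ p}

open Classical in
/-- The vertices from which an iteration may start. -/
noncomputable def startSet (𝒢 : Set X) (G : X) : Finset V :=
  {v | (inNbrs 𝒢 G v).Nonempty}

/-- Replace the edge `ab` by the edge `ac`. -/
def swapEdge (G : X) (a b c : V) : X := addEdge (removeEdge G a b) a c

open Classical in
/-- `exitProb 𝒢 w₀ k G p w H` is the probability that the repeat-loop, entered with current graph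
`G`, `W₀ = w₀`, `W_{n-1} = p` and `W_n = w`, stops after exactly `k` passes and returns `H`.
In one pass `W_{n+1} = a` is drawn from `N_G(w) ∖ {p}`, then `W_{n+2} = b` from `M_G(a)`, then the
edge `aw` is replaced by `ab`; the loop stops if `b = w₀`. -/
noncomputable def exitProb (𝒢 : Set X) (w₀ : V) : ℕ → X → Option V → V → X → ℝ≥0∞
  | 0, _, _, _, _ => 0
  | k + 1, G, p, w, H =>
      ∑ a : V, ∑ b : V, unif (inNbrsAvoid 𝒢 G p w) a * unif (nonOutNbrs 𝒢 G a) b *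
        (if b = w₀ then
          (if k = 0 ∧ swapEdge G a w b = H then 1 else 0)
        else exitProb 𝒢 w₀ k (swapEdge G a w b) (some a) b H)

open Classical in
/-- The probability that one iteration, started from `G`, terminates and returns `H`. If there is
no vertex to start from, the iteration does nothing. -/
noncomputable def iterProb (𝒢 : Set X) (G H : X) : ℝ≥0∞ :=
  if (startSet 𝒢 G).Nonempty then
    ∑ w₀ : V, unif (startSet 𝒢 G) w₀ * ∑' k : ℕ, exitProb 𝒢 w₀ k G none w₀ H
  else if G = H then 1 else 0

/-- The transition matrix of the sampler, on the state space `𝒢`. -/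
noncomputable def transition (𝒢 : Set X) : Matrix 𝒢 𝒢 ℝ :=
  Matrix.of fun G H => (iterProb 𝒢 (G : X) (H : X)).toReal

end

end UGS

/-!
Both halves of a pass through the loop are reversible: replacing `aw` by `ab` preserves the
size of `M(a)`, and turning from `a` to another element of `N(w)` is a uniform choice from a set
whose size depends on `w` only. Hence an iteration is an alternating product of two
symmetric operators that starts and ends with the same one, `Q` is symmetric, and the uniform
distribution is stationary.

If `G ≠ H`, equality of the degrees lets an iteration from `G` remove edges of `E(G) ∖ E(H)` and add
edges of `E(H) ∖ E(G)` in alternation until it is back at `W₀`. This decreases `|E(G) ∖ E(H)|`, so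
`Q` is irreducible. The same walk leads out of every situation that can occur in the loop, so by the
minimum principle on the finite set of situations an iteration terminates almost surely. Convergence
of the averages of `Q^k` is the mean ergodic theorem.
-/

/-! ### Finite Markov chains -/

section Markov

open Matrix Finset Filter
open scoped Topology

variable {S : Type*} [Fintype S] [DecidableEq S] {P : Matrix S S ℝ}

theorem exists_pow_pos_of_descent (hP : ∀ i j, 0 ≤ P i j) (r : S → ℕ) {j : S}
    (h : ∀ i, i ≠ j → ∃ i', 0 < P i i' ∧ r i' < r i) (i : S) : ∃ k, 0 < (P ^ k) i j := by
  induction hr : r i using Nat.strong_induction_on generalizing i with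
  | _ n ih =>
    by_cases hij : i = j
    · exact ⟨0, by simp [hij]⟩
    · obtain ⟨i', hi', hlt⟩ := h i hij
      obtain ⟨k, hk⟩ := ih (r i') (hr ▸ hlt) i' rfl
      refine ⟨k + 1, ?_⟩
      rw [pow_succ', mul_apply]
      exact sum_pos' (fun l _ => mul_nonneg (hP i l) (pow_apply_nonneg hP k l j))
        ⟨i', mem_univ i', mul_pos hi' hk⟩

theorem isIrreducible_of_rowStochastic (hP : P ∈ rowStochastic ℝ S)
    (h : ∀ i j, ∃ k, 0 < (P ^ k) i j) : P.IsIrreducible := by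
  rw [isIrreducible_iff_exists_pow_pos hP.1]
  intro i j
  obtain ⟨l, -, hl⟩ : ∃ l ∈ univ, 0 < P i l :=
    exists_lt_of_sum_lt (by simp [sum_row_of_mem_rowStochastic hP])
  obtain ⟨k, hk⟩ := h l j
  refine ⟨k + 1, k.succ_pos, ?_⟩
  rw [pow_succ', mul_apply]
  exact sum_pos' (fun m _ => mul_nonneg (hP.1 i m) ((pow_mem hP k).1 m j))
    ⟨l, mem_univ l, mul_pos hl hk⟩

theorem pow_mulVec_of_mulVec_eq {u : S → ℝ} (hu : P *ᵥ u = u) (k : ℕ) : (P ^ k) *ᵥ u = u := by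
  rw [← toLin'_apply, toLin'_pow, Module.End.pow_apply]
  exact Function.iterate_fixed hu k

theorem eq_of_mulVec_eq (hP : P ∈ rowStochastic ℝ S) (h : P.IsIrreducible) {u : S → ℝ}
    (hu : P *ᵥ u = u) (i j : S) : u i = u j := by
  have : Nonempty S := ⟨i⟩
  obtain ⟨m, hm⟩ := Finite.exists_max u
  suffices H : ∀ j, u j = u m by rw [H i, H j]
  intro j
  obtain ⟨k, -, hk⟩ := (isIrreducible_iff_exists_pow_pos hP.1).1 h m j
  have hPk := pow_mem hP k
  have hmean : ∑ l, (P ^ k) m l * u l = u m := congrFun (pow_mulVec_of_mulVec_eq hu k) m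
  have hsum : ∑ l, (P ^ k) m l * (u m - u l) = 0 := by
    simp only [mul_sub, sum_sub_distrib, ← sum_mul, hmean, sum_row_of_mem_rowStochastic hPk m,
      one_mul, sub_self]
  have hj := (sum_eq_zero_iff_of_nonneg
    fun l _ => mul_nonneg (hPk.1 m l) (sub_nonneg.2 (hm l))).1 hsum j (mem_univ j)
  exact (sub_eq_zero.1 ((mul_eq_zero.1 hj).resolve_left hk.ne')).symm

theorem dotProduct_eq_of_mulVec_eq (hP : P ∈ rowStochastic ℝ S) (h : P.IsIrreducible) {π u : S → ℝ}
    (hπ : π ∈ stdSimplex ℝ S) (hu : P *ᵥ u = u) (i : S) : π ⬝ᵥ u = u i := by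
  simp only [dotProduct, eq_of_mulVec_eq hP h hu _ i, ← sum_mul, hπ.2, one_mul]

theorem lipschitzWith_one_toLin' (hP : P ∈ rowStochastic ℝ S) : LipschitzWith 1 (toLin' P) := by
  refine AddMonoidHomClass.lipschitz_of_bound_nnnorm (toLin' P) 1 fun u => ?_
  rw [one_mul, ← NNReal.coe_le_coe, coe_nnnorm, coe_nnnorm,
    pi_norm_le_iff_of_nonneg (norm_nonneg u)]
  intro i
  calc ‖∑ j, P i j * u j‖ ≤ ∑ j, P i j * ‖u j‖ := by
        refine (norm_sum_le _ _).trans_eq (sum_congr rfl fun j _ => ?_)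
        rw [norm_mul, Real.norm_of_nonneg (hP.1 i j)]
    _ ≤ ∑ j, P i j * ‖u‖ :=
        sum_le_sum fun j _ => mul_le_mul_of_nonneg_left (norm_le_pi_norm u j) (hP.1 i j)
    _ = ‖u‖ := by rw [← sum_mul, sum_row_of_mem_rowStochastic hP, one_mul]

theorem range_toLin'_sub_one (hP : P ∈ rowStochastic ℝ S) (h : P.IsIrreducible) {π : S → ℝ}
    (hπ : π ∈ stdSimplex ℝ S) (hst : π ᵥ* P = π) :
    LinearMap.range (toLin' P - 1) = LinearMap.ker (dotProductEquiv ℝ S π) := by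
  refine Submodule.eq_of_le_of_finrank_le ?_ ?_
  · rintro _ ⟨u, rfl⟩
    simp [dotProduct_sub, dotProduct_mulVec, hst]
  · have hπ0 : dotProductEquiv ℝ S π ≠ 0 := by
      rw [Ne, LinearEquiv.map_eq_zero_iff]
      rintro rfl
      simpa using hπ.2
    have hker : LinearMap.ker (toLin' P - 1) ≤ ℝ ∙ (1 : S → ℝ) := by
      intro u hu
      have hu : P *ᵥ u = u := by simpa [sub_eq_zero] using hu
      rw [Submodule.mem_span_singleton]
      exact ⟨π ⬝ᵥ u, funext fun i => by
        rw [dotProduct_eq_of_mulVec_eq hP h hπ hu i, Pi.smul_apply, Pi.one_apply, smul_eq_mul,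
          mul_one]⟩
    have hker := (Submodule.finrank_mono hker).trans (finrank_span_le_card {1})
    rw [Set.toFinset_singleton, card_singleton] at hker
    have hrank := (toLin' P - 1).finrank_range_add_finrank_ker
    have hrank' := Module.Dual.finrank_ker_add_one_of_ne_zero hπ0
    omega

theorem tendsto_average_pow (hP : P ∈ rowStochastic ℝ S) (h : P.IsIrreducible) {π : S → ℝ}
    (hπ : π ∈ stdSimplex ℝ S) (hst : π ᵥ* P = π) (x y : S) :
    Tendsto (fun n : ℕ => (n : ℝ)⁻¹ * ∑ k ∈ range n, (P ^ k) x y) atTop (𝓝 (π y)) := by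
  have hmean (u : S → ℝ) : (fun _ => π ⬝ᵥ u) ∈ LinearMap.eqLocus (toLin' P) 1 := by
    ext i
    simp [mulVec, dotProduct, ← sum_mul, sum_row_of_mem_rowStochastic hP]
  let mean : (S → ℝ) →ₗ[ℝ] LinearMap.eqLocus (toLin' P) 1 :=
    (LinearMap.pi fun _ => dotProductEquiv ℝ S π).codRestrict _ hmean
  have hproj (u : LinearMap.eqLocus (toLin' P) 1) : mean.toContinuousLinearMap u = u := by
    ext i
    exact dotProduct_eq_of_mulVec_eq hP h hπ u.2 i
  have hker : (mean.toContinuousLinearMap.ker : Set (S → ℝ)) ⊆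
      closure (LinearMap.range (toLin' P - 1)) := by
    refine subset_closure.trans' fun u hu => ?_
    rw [range_toLin'_sub_one hP h hπ hst]
    exact congrFun (congrArg Subtype.val hu) x
  have hlim := tendsto_pi_nhds.1 (LinearMap.tendsto_birkhoffAverage_of_ker_subset_closure (toLin' P)
    (lipschitzWith_one_toLin' hP) mean.toContinuousLinearMap hproj hker (Pi.single y 1)) x
  have hval : (mean.toContinuousLinearMap (Pi.single y 1) : S → ℝ) x = π y :=
    dotProduct_single_one π y
  rw [hval] at hlim
  simpa [birkhoffAverage, birkhoffSum, ← Module.End.pow_apply, ← toLin'_pow] using hlim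

theorem isErgodicChain_uniformDist [Nonempty S] (hP : P ∈ rowStochastic ℝ S) (hsymm : P.IsSymm)
    (h : ∀ i j, ∃ k, 0 < (P ^ k) i j) : IsErgodicChain P (uniformDist S) := by
  have hirr := isIrreducible_of_rowStochastic hP h
  have hprob : uniformDist S ∈ stdSimplex ℝ S :=
    ⟨fun i => by simp only [uniformDist]; positivity, by simp [uniformDist]⟩
  have hst : uniformDist S ᵥ* P = uniformDist S := by
    rw [← mulVec_transpose, hsymm.eq]
    ext i
    simp only [mulVec, dotProduct, uniformDist, ← sum_mul, sum_row_of_mem_rowStochastic hP, one_mul]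
  exact ⟨hP, hprob, hst, hirr, tendsto_average_pow hP hirr hprob hst⟩

end Markov

namespace UGS

open EditableGraph

/-! ### Exchanging an edge -/

theorem ncard_preimage_exchange {α β : Type*} [Finite α] (f : α → β) {s : Set β} {e e' : β}
    (he : e ∈ s) (he' : e' ∉ s) :
    (f ⁻¹' insert e' (s \ {e})).ncard + (f ⁻¹' {e}).ncard =
      (f ⁻¹' s).ncard + (f ⁻¹' {e'}).ncard := by
  have hdisj : Disjoint (f ⁻¹' {e'}) (f ⁻¹' s \ f ⁻¹' {e}) :=
    Set.disjoint_left.2 fun x hx hxs => he' ((show f x = e' from hx) ▸ hxs.1)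
  have hsub : f ⁻¹' {e} ⊆ f ⁻¹' s := Set.preimage_mono (Set.singleton_subset_iff.2 he)
  rw [Set.insert_eq, Set.preimage_union, Set.preimage_sdiff, Set.ncard_union_eq hdisj, add_assoc,
    Set.ncard_sdiff_add_ncard_of_subset hsub, add_comm]

theorem ncard_setOf_sym2_mk_eq {V : Type*} {a w : V} (h : a ≠ w) (v : V) :
    {u | s(v, u) = s(a, w)}.ncard = Finsupp.single a 1 v + Finsupp.single w 1 v := by
  by_cases ha : v = a
  · subst ha
    simp [h]
  · by_cases hw : v = w
    · subst hw
      simp [Ne.symm h, eq_comm, h]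
    · simp [ha, hw]

universe u

/-- A kind of graph on `V` for which a graph is a set of edges. It gives a uniform treatment of
digraphs, whose edges are in `V × V`, and of simple graphs, whose edges are in `Sym2 V`. An edge
`uv` counts for the in-degree of `v` and the out-degree of `u`, and in addition with weight
`flipWeight` for the in-degree of `u` and the out-degree of `v`. -/
class GraphKind (X : Type*) {V : outParam (Type u)} [EditableGraph X V] where
  Edge (X) : Type u
  edge (X) : V → V → Edge
  edges : X → Set Edge
  flipWeight (X) : ℕ
  mem_edges {G : X} {u v : V} : edge u v ∈ edges G ↔ HasEdge G u v
  edges_injective : Function.Injective edges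
  edge_surjective (e : Edge) : ∃ u v, edge u v = e
  edge_injective (u : V) : Function.Injective (edge u)
  edges_swapEdge {G H : X} {a w b : V} (hb : HasEdge H a b) :
    edges (swapEdge G a w b) = insert (edge a b) (edges G \ {edge a w})
  ncard_in {G : X} {a w : V} (h : HasEdge G a w) (v : V) : {u | edge u v = edge a w}.ncard =
    Finsupp.single w 1 v + Finsupp.single a flipWeight v
  ncard_out {G : X} {a w : V} (h : HasEdge G a w) (v : V) : {u | edge v u = edge a w}.ncard =
    Finsupp.single a 1 v + Finsupp.single w flipWeight v

open GraphKind

instance instGraphKindDigraph (V : Type*) : GraphKind (Digraph V) where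
  Edge := V × V
  edge := Prod.mk
  edges := Digraph.edges
  flipWeight := 0
  mem_edges := Iff.rfl
  edges_injective G H h := Digraph.ext (funext₂ fun u v => congrFun h (u, v))
  edge_surjective e := ⟨e.1, e.2, rfl⟩
  edge_injective := Prod.mk_right_injective
  edges_swapEdge {G H a w b} _ := by
    ext e
    change (G.Adj e.1 e.2 ∧ ¬(e.1 = a ∧ e.2 = w)) ∨ (e.1 = a ∧ e.2 = b) ↔
      e = (a, b) ∨ (G.Adj e.1 e.2 ∧ e ≠ (a, w))
    rw [Ne, Prod.ext_iff, Prod.ext_iff, or_comm]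
  ncard_in {G a w} _ v := by
    classical
    simp only [Prod.mk.injEq, Finsupp.single_apply]
    by_cases h : w = v <;> simp [h, eq_comm]
  ncard_out {G a w} _ v := by
    classical
    simp only [Prod.mk.injEq, Finsupp.single_apply]
    by_cases h : a = v <;> simp [h, eq_comm]

instance instGraphKindSimpleGraph (V : Type*) : GraphKind (SimpleGraph V) where
  Edge := Sym2 V
  edge u v := s(u, v)
  edges := SimpleGraph.edgeSet
  flipWeight := 1
  mem_edges := Iff.rfl
  edges_injective := SimpleGraph.edgeSet_injective
  edge_surjective := Sym2.ind fun u v => ⟨u, v, rfl⟩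
  edge_injective u _ _ h := Sym2.congr_right.1 h
  edges_swapEdge {G H a w b} hb := by
    change (G.deleteEdges {s(a, w)} ⊔ SimpleGraph.edge a b).edgeSet = _
    rw [SimpleGraph.edgeSet_sup, SimpleGraph.edgeSet_deleteEdges,
      SimpleGraph.edgeSet_edge_of_ne (SimpleGraph.Adj.ne hb), Set.union_comm]
    rfl
  ncard_in {G a w} h v := by
    simp only [Sym2.eq_swap (b := v)]
    rw [ncard_setOf_sym2_mk_eq (SimpleGraph.Adj.ne h), add_comm]
  ncard_out h v := ncard_setOf_sym2_mk_eq (SimpleGraph.Adj.ne h) v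

section

variable {V X : Type*} [EditableGraph X V]

/-- The number of edges of `G` with head `v`; the degree of `v` if `G` is a simple graph. -/
noncomputable def inDegree (G : X) (v : V) : ℕ := {u | HasEdge G u v}.ncard

/-- The number of edges of `G` with tail `v`; the degree of `v` if `G` is a simple graph. -/
noncomputable def outDegree (G : X) (v : V) : ℕ := {u | HasEdge G v u}.ncard

variable [GraphKind X]

theorem finite_edge (X : Type*) [EditableGraph X V] [GraphKind X] [Finite V] : Finite (Edge X) :=
  Finite.of_surjective (fun p : V × V => edge X p.1 p.2) fun e =>
    let ⟨u, v, h⟩ := edge_surjective e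
    ⟨(u, v), h⟩

theorem finite_graph [Finite V] : Finite X :=
  have : Finite (Edge X) := finite_edge X
  Finite.of_injective edges edges_injective

section

variable {G H : X} {a b w : V}

theorem hasEdge_swapEdge (hb : HasEdge H a b) {x y : V} :
    HasEdge (swapEdge G a w b) x y ↔
      edge X x y = edge X a b ∨ HasEdge G x y ∧ edge X x y ≠ edge X a w := by
  rw [← mem_edges, edges_swapEdge hb, ← mem_edges]
  rfl

theorem hasEdge_swapEdge_tail (hb : HasEdge H a b) {y : V} :
    HasEdge (swapEdge G a w b) a y ↔ y = b ∨ HasEdge G a y ∧ y ≠ w := by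
  rw [hasEdge_swapEdge hb, Ne, (edge_injective a).eq_iff, (edge_injective a).eq_iff]

theorem swapEdge_swapEdge (hw : HasEdge G a w) (hb : ¬ HasEdge G a b) (hb' : HasEdge H a b) :
    swapEdge (swapEdge G a w b) a b w = G := by
  apply edges_injective
  rw [edges_swapEdge hw, edges_swapEdge hb', Set.insert_sdiff_self_of_notMem,
    Set.insert_sdiff_self_of_mem (mem_edges.2 hw)]
  exact fun h => hb (mem_edges.1 h.1)

theorem inDegree_swapEdge [Finite V] (hw : HasEdge G a w) (hb : ¬ HasEdge G a b)
    (hb' : HasEdge H a b) (v : V) :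
    inDegree (swapEdge G a w b) v + Finsupp.single w 1 v = inDegree G v + Finsupp.single b 1 v := by
  have h := ncard_preimage_exchange (edge X · v) (mem_edges.2 hw) (mt mem_edges.1 hb)
  have hw := ncard_in hw v
  have hb := ncard_in hb' v
  rw [← edges_swapEdge hb'] at h
  simp only [inDegree, ← mem_edges (G := G), ← mem_edges (G := swapEdge G a w b)]
  simp only [Set.preimage, Set.mem_singleton_iff] at h
  omega

theorem outDegree_swapEdge [Finite V] (hw : HasEdge G a w) (hb : ¬ HasEdge G a b)
    (hb' : HasEdge H a b) (v : V) :
    outDegree (swapEdge G a w b) v + Finsupp.single w (flipWeight X) v =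
      outDegree G v + Finsupp.single b (flipWeight X) v := by
  have h := ncard_preimage_exchange (edge X v) (mem_edges.2 hw) (mt mem_edges.1 hb)
  have hw := ncard_out hw v
  have hb := ncard_out hb' v
  rw [← edges_swapEdge hb'] at h
  simp only [outDegree, ← mem_edges (G := G), ← mem_edges (G := swapEdge G a w b)]
  simp only [Set.preimage, Set.mem_singleton_iff] at h
  omega

theorem single_flipWeight_of_hasEdge (h : HasEdge G a w) :
    Finsupp.single w (flipWeight X) a = 0 := by
  have hcard := ncard_out h a
  simp only [(edge_injective (X := X) a).eq_iff, Set.ofPred_eq_eq_singleton, Set.ncard_singleton,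
    Finsupp.single_eq_same] at hcard
  omega

end

end

section

variable {V X : Type*} [EditableGraph X V] {𝒢 : Set X} {G H : X} {u v w : V}

theorem exists_hasEdge_of_not_known (h : ¬ Known 𝒢 u v) : ∃ G ∈ 𝒢, HasEdge G u v := by
  by_contra! hc
  exact h (Or.inr hc)

theorem exists_not_hasEdge_of_not_known (h : ¬ Known 𝒢 u v) : ∃ G ∈ 𝒢, ¬ HasEdge G u v := by
  by_contra! hc
  exact h (Or.inl hc)

theorem Known.hasEdge_iff (h : Known 𝒢 u v) (hG : G ∈ 𝒢) (hH : H ∈ 𝒢) :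
    HasEdge G u v ↔ HasEdge H u v := by
  rcases h with h | h
  · exact iff_of_true (h G hG) (h H hH)
  · exact iff_of_false (h G hG) (h H hH)

theorem known_congr [GraphKind X] {u' v' : V} (h : edge X u v = edge X u' v') :
    Known 𝒢 u v ↔ Known 𝒢 u' v' := by
  simp only [Known, ← mem_edges (X := X), h]

theorem hasEdge_swapEdge_of_known [GraphKind X] {a b x y : V} (haw : ¬ Known 𝒢 a w)
    (hab : ¬ Known 𝒢 a b) (hxy : Known 𝒢 x y) :
    HasEdge (swapEdge G a w b) x y ↔ HasEdge G x y := by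
  obtain ⟨H, -, hb⟩ := exists_hasEdge_of_not_known hab
  rw [hasEdge_swapEdge hb, or_iff_right fun h => hab ((known_congr h).1 hxy),
    and_iff_left fun h => haw ((known_congr h).1 hxy)]

variable [Fintype V]

@[simp]
theorem mem_inNbrs : v ∈ inNbrs 𝒢 G u ↔ HasEdge G v u ∧ ¬ Known 𝒢 v u := by
  simp [inNbrs]

@[simp]
theorem mem_nonOutNbrs : v ∈ nonOutNbrs 𝒢 G u ↔ ¬ HasEdge G u v ∧ ¬ Known 𝒢 u v := by
  simp [nonOutNbrs]

@[simp]
theorem mem_inNbrsAvoid {p : Option V} :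
    v ∈ inNbrsAvoid 𝒢 G p u ↔ v ∈ inNbrs 𝒢 G u ∧ some v ≠ p := by
  simp [inNbrsAvoid]

@[simp]
theorem mem_startSet : v ∈ startSet 𝒢 G ↔ (inNbrs 𝒢 G v).Nonempty := by
  simp [startSet]

theorem ne_of_mem_inNbrs_of_mem_nonOutNbrs {a b : V} (ha : a ∈ inNbrs 𝒢 G w)
    (hb : b ∈ nonOutNbrs 𝒢 G a) : w ≠ b := by
  rintro rfl
  exact (mem_nonOutNbrs.1 hb).1 (mem_inNbrs.1 ha).1

theorem inDegree_eq_card_inNbrs_add (𝒢 : Set X) (G : X) (w : V) :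
    inDegree G w = (inNbrs 𝒢 G w).card + {v | HasEdge G v w ∧ Known 𝒢 v w}.ncard := by
  have hset : {v | HasEdge G v w} = ↑(inNbrs 𝒢 G w) ∪ {v | HasEdge G v w ∧ Known 𝒢 v w} := by
    ext v
    simp only [Set.mem_ofPred_eq, Set.mem_union, Finset.mem_coe, mem_inNbrs]
    grind
  rw [inDegree, hset, Set.ncard_union_eq, Set.ncard_coe_finset]
  exact Set.disjoint_left.2 fun v hv hv' => (mem_inNbrs.1 hv).2 hv'.2

end

section

variable {V X : Type*} [EditableGraph X V] [GraphKind X] [Fintype V] {𝒢 : Set X} {G : X}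
  {a b w : V}

theorem mem_inNbrs_swapEdge (hb : b ∈ nonOutNbrs 𝒢 G a) : a ∈ inNbrs 𝒢 (swapEdge G a w b) b := by
  rw [mem_nonOutNbrs] at hb
  obtain ⟨H, -, hab⟩ := exists_hasEdge_of_not_known hb.2
  exact mem_inNbrs.2 ⟨(hasEdge_swapEdge hab).2 (Or.inl rfl), hb.2⟩

variable (ha : a ∈ inNbrs 𝒢 G w) (hb : b ∈ nonOutNbrs 𝒢 G a)
include ha hb

theorem nonOutNbrs_swapEdge [DecidableEq V] :
    nonOutNbrs 𝒢 (swapEdge G a w b) a = insert w ((nonOutNbrs 𝒢 G a).erase b) := by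
  have hwb := ne_of_mem_inNbrs_of_mem_nonOutNbrs ha hb
  rw [mem_inNbrs] at ha
  rw [mem_nonOutNbrs] at hb
  obtain ⟨H, -, hab⟩ := exists_hasEdge_of_not_known hb.2
  ext y
  simp only [mem_nonOutNbrs, hasEdge_swapEdge_tail hab, Finset.mem_insert, Finset.mem_erase]
  grind

theorem mem_nonOutNbrs_swapEdge : w ∈ nonOutNbrs 𝒢 (swapEdge G a w b) a := by
  classical
  rw [nonOutNbrs_swapEdge ha hb]
  exact Finset.mem_insert_self _ _

theorem card_nonOutNbrs_swapEdge :
    (nonOutNbrs 𝒢 (swapEdge G a w b) a).card = (nonOutNbrs 𝒢 G a).card := by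
  classical
  have hw : w ∉ nonOutNbrs 𝒢 G a := fun h => (mem_nonOutNbrs.1 h).1 (mem_inNbrs.1 ha).1
  rw [nonOutNbrs_swapEdge ha hb,
    Finset.card_insert_of_notMem fun h => hw (Finset.mem_of_mem_erase h),
    Finset.card_erase_add_one hb]

theorem swapEdge_swapEdge_of_mem : swapEdge (swapEdge G a w b) a b w = G := by
  rw [mem_nonOutNbrs] at hb
  obtain ⟨H, -, hab⟩ := exists_hasEdge_of_not_known hb.2
  exact swapEdge_swapEdge (mem_inNbrs.1 ha).1 hb.1 hab

end

/-! ### Graphs of the class, and graphs in the course of an iteration -/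

section

variable {V X : Type*} [EditableGraph X V]

/-- What the sampler needs to know about its state space: `𝒢` consists of all graphs with given
degrees that agree with the members of `𝒢` wherever these agree with each other. -/
structure IsDegreeClass (𝒢 : Set X) : Prop where
  nonempty : 𝒢.Nonempty
  inDegree_eq {G H : X} (hG : G ∈ 𝒢) (hH : H ∈ 𝒢) (v : V) : inDegree G v = inDegree H v
  outDegree_eq {G H : X} (hG : G ∈ 𝒢) (hH : H ∈ 𝒢) (v : V) : outDegree G v = outDegree H v
  mem {G H : X} (hH : H ∈ 𝒢) (hin : ∀ v, inDegree G v = inDegree H v)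
    (hout : ∀ v, outDegree G v = outDegree H v)
    (hknown : ∀ u v, Known 𝒢 u v → (HasEdge G u v ↔ HasEdge H u v)) : G ∈ 𝒢

/-- The graphs that can occur while an iteration started at `w₀` is at `w`: the degrees are those
of the members of `𝒢`, except that a head `w₀` has been traded for a head `w`. -/
structure IsIntermediate [GraphKind X] (𝒢 : Set X) (w₀ w : V) (G : X) : Prop where
  inDegree_add {H : X} (hH : H ∈ 𝒢) (v : V) :
    inDegree G v + Finsupp.single w₀ 1 v = inDegree H v + Finsupp.single w 1 v
  outDegree_add {H : X} (hH : H ∈ 𝒢) (v : V) :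
    outDegree G v + Finsupp.single w₀ (flipWeight X) v =
      outDegree H v + Finsupp.single w (flipWeight X) v
  hasEdge_iff {H : X} (hH : H ∈ 𝒢) {u v : V} (huv : Known 𝒢 u v) : HasEdge G u v ↔ HasEdge H u v

variable [GraphKind X]

/-- The graphs with the degrees of `G₀` that agree with `G₀` on `F`. -/
def degreeClass (G₀ : X) (F : Set (Edge X)) : Set X :=
  {G | (∀ v, inDegree G v = inDegree G₀ v ∧ outDegree G v = outDegree G₀ v) ∧
    edges G ∩ F = edges G₀ ∩ F}

theorem known_degreeClass {G₀ : X} {F : Set (Edge X)} {u v : V} (h : edge X u v ∈ F) :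
    Known (degreeClass G₀ F) u v := by
  have hiff (G) (hG : G ∈ degreeClass G₀ F) : HasEdge G u v ↔ HasEdge G₀ u v := by
    have := Set.ext_iff.1 hG.2 (edge X u v)
    simpa only [Set.mem_inter_iff, h, and_true, mem_edges] using this
  by_cases h₀ : HasEdge G₀ u v
  · exact Or.inl fun G hG => (hiff G hG).2 h₀
  · exact Or.inr fun G hG => mt (hiff G hG).1 h₀

theorem isDegreeClass_degreeClass (G₀ : X) (F : Set (Edge X)) :
    IsDegreeClass (degreeClass G₀ F) where
  nonempty := ⟨G₀, fun _ => ⟨rfl, rfl⟩, rfl⟩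
  inDegree_eq hG hH v := (hG.1 v).1.trans (hH.1 v).1.symm
  outDegree_eq hG hH v := (hG.1 v).2.trans (hH.1 v).2.symm
  mem {G H} hH hin hout hknown := by
    refine ⟨fun v => ⟨(hin v).trans (hH.1 v).1, (hout v).trans (hH.1 v).2⟩, Eq.trans ?_ hH.2⟩
    ext e
    obtain ⟨u, v, rfl⟩ := edge_surjective e
    simp only [Set.mem_inter_iff, mem_edges]
    exact and_congr_left fun huv => hknown u v (known_degreeClass huv)

theorem directedClass_eq_degreeClass {V : Type*} (G₀ : Digraph V) (F : Set (V × V)) :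
    directedClass G₀ F = degreeClass G₀ F := rfl

theorem undirectedClass_eq_degreeClass {V : Type*} [Fintype V] (G₀ : SimpleGraph V)
    (F : Set (Sym2 V)) : undirectedClass G₀ F = degreeClass G₀ F := by
  classical
  have hout (G : SimpleGraph V) (v : V) : outDegree G v = G.degree v := by
    rw [← SimpleGraph.card_neighborSet_eq_degree, ← Nat.card_eq_fintype_card]
    rfl
  have hin (G : SimpleGraph V) (v : V) : inDegree G v = G.degree v := by
    simp only [← hout, inDegree, outDegree, HasEdge, SimpleGraph.adj_comm]
  ext G
  simp only [degreeClass, undirectedClass, hin, hout, and_self]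
  rfl

variable {𝒢 : Set X} {G H : X} {w₀ w a : V}

theorem IsDegreeClass.isIntermediate_self_iff (h𝒢 : IsDegreeClass 𝒢) :
    IsIntermediate 𝒢 w₀ w₀ G ↔ G ∈ 𝒢 := by
  constructor
  · intro hG
    obtain ⟨H, hH⟩ := h𝒢.nonempty
    exact h𝒢.mem hH (fun v => Nat.add_right_cancel (hG.inDegree_add hH v))
      (fun v => Nat.add_right_cancel (hG.outDegree_add hH v)) fun u v => hG.hasEdge_iff hH
  · intro hG
    exact ⟨fun hH v => by rw [h𝒢.inDegree_eq hG hH], fun hH v => by rw [h𝒢.outDegree_eq hG hH],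
      fun hH _ _ huv => huv.hasEdge_iff hG hH⟩

namespace IsIntermediate

theorem not_known_of_not_iff (hG : IsIntermediate 𝒢 w₀ w G) (hH : H ∈ 𝒢) {u v : V}
    (h : ¬ (HasEdge G u v ↔ HasEdge H u v)) : ¬ Known 𝒢 u v :=
  fun hk => h (hG.hasEdge_iff hH hk)

theorem exists_hasEdge_head [Finite V] (hG : IsIntermediate 𝒢 w₀ w G) (hH : H ∈ 𝒢) (hw : w ≠ w₀) :
    ∃ c, HasEdge G c w ∧ ¬ HasEdge H c w := by
  by_contra! hc
  have hle : inDegree G w ≤ inDegree H w := Set.ncard_le_ncard hc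
  have hdeg := hG.inDegree_add hH w
  rw [Finsupp.single_eq_same, Finsupp.single_eq_of_ne hw] at hdeg
  omega

theorem exists_hasEdge_tail [Finite V] (hG : IsIntermediate 𝒢 w₀ w G) (hH : H ∈ 𝒢)
    (ha : HasEdge G a w) (ha' : ¬ HasEdge H a w) : ∃ b, HasEdge H a b ∧ ¬ HasEdge G a b := by
  by_contra! hc
  have hle : outDegree G a ≤ outDegree H a := by
    have hdeg := hG.outDegree_add hH a
    rw [single_flipWeight_of_hasEdge ha] at hdeg
    omega
  have heq := Set.eq_of_subset_of_ncard_le (s := {b | HasEdge H a b}) hc hle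
  exact ha' (heq.ge ha)

variable [Fintype V]

theorem nonOutNbrs_nonempty (hG : IsIntermediate 𝒢 w₀ w G) (ha : a ∈ inNbrs 𝒢 G w) :
    (nonOutNbrs 𝒢 G a).Nonempty := by
  rw [mem_inNbrs] at ha
  obtain ⟨H, hH, haH⟩ := exists_not_hasEdge_of_not_known ha.2
  obtain ⟨b, hb, hb'⟩ := hG.exists_hasEdge_tail hH ha.1 haH
  exact ⟨b, mem_nonOutNbrs.2 ⟨hb', hG.not_known_of_not_iff hH fun h => hb' (h.2 hb)⟩⟩

theorem card_inNbrs_add (hG : IsIntermediate 𝒢 w₀ w G) (hH : H ∈ 𝒢) (v : V) :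
    (inNbrs 𝒢 G v).card + Finsupp.single w₀ 1 v =
      (inNbrs 𝒢 H v).card + Finsupp.single w 1 v := by
  have hknown : {u | HasEdge G u v ∧ Known 𝒢 u v} = {u | HasEdge H u v ∧ Known 𝒢 u v} :=
    Set.ext fun u => and_congr_left (hG.hasEdge_iff hH)
  have hdeg := hG.inDegree_add hH v
  rw [inDegree_eq_card_inNbrs_add 𝒢 G, inDegree_eq_card_inNbrs_add 𝒢 H, hknown] at hdeg
  omega

protected theorem swapEdge (hG : IsIntermediate 𝒢 w₀ w G) {b : V} (ha : a ∈ inNbrs 𝒢 G w)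
    (hb : b ∈ nonOutNbrs 𝒢 G a) : IsIntermediate 𝒢 w₀ b (swapEdge G a w b) := by
  rw [mem_inNbrs] at ha
  rw [mem_nonOutNbrs] at hb
  obtain ⟨H, -, hab⟩ := exists_hasEdge_of_not_known hb.2
  refine ⟨fun hK v => ?_, fun hK v => ?_, fun hK u v huv => ?_⟩
  · have := inDegree_swapEdge ha.1 hb.1 hab v
    have := hG.inDegree_add hK v
    omega
  · have := outDegree_swapEdge ha.1 hb.1 hab v
    have := hG.outDegree_add hK v
    omega
  · rw [hasEdge_swapEdge_of_known ha.2 hb.2 huv, hG.hasEdge_iff hK huv]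

end IsIntermediate

theorem IsDegreeClass.card_inNbrs_eq [Fintype V] (h𝒢 : IsDegreeClass 𝒢) (hG : G ∈ 𝒢) (hH : H ∈ 𝒢)
    (v : V) : (inNbrs 𝒢 G v).card = (inNbrs 𝒢 H v).card :=
  Nat.add_right_cancel ((h𝒢.isIntermediate_self_iff (w₀ := v).2 hG).card_inNbrs_add hH v)

theorem IsDegreeClass.startSet_eq [Fintype V] (h𝒢 : IsDegreeClass 𝒢) (hG : G ∈ 𝒢) (hH : H ∈ 𝒢) :
    startSet 𝒢 G = startSet 𝒢 H := by
  ext v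
  rw [mem_startSet, mem_startSet, ← Finset.card_pos, ← Finset.card_pos, h𝒢.card_inNbrs_eq hG hH]

end

section

variable {V X : Type*} [EditableGraph X V] [GraphKind X] {𝒢 : Set X} {G H : X} {w : V}

/-- The number of edges of `G` that are not edges of `H`. -/
noncomputable def excess (G H : X) : ℕ := (edges G \ edges H).ncard

theorem excess_swapEdge_lt [Finite V] {a b : V} (hw : HasEdge G a w) (hw' : ¬ HasEdge H a w)
    (hb : HasEdge H a b) : excess (swapEdge G a w b) H < excess G H := by
  have : Finite (Edge X) := finite_edge X
  have hsub : edges (swapEdge G a w b) \ edges H = (edges G \ edges H) \ {edge X a w} := by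
    rw [edges_swapEdge hb, Set.insert_sdiff_of_mem _ (mem_edges.2 hb), sdiff_sdiff_comm]
  have hmem : edge X a w ∈ edges G \ edges H := ⟨mem_edges.2 hw, mt mem_edges.1 hw'⟩
  rw [excess, hsub]
  exact Set.ncard_sdiff_singleton_lt_of_mem hmem

theorem IsDegreeClass.exists_hasEdge_of_ne [Finite V] (h𝒢 : IsDegreeClass 𝒢) (hG : G ∈ 𝒢)
    (hH : H ∈ 𝒢) (hne : G ≠ H) : ∃ c w, HasEdge G c w ∧ ¬ HasEdge H c w := by
  by_contra! hsub
  refine hne (edges_injective (Set.ext fun e => ?_))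
  obtain ⟨u, v, rfl⟩ := edge_surjective e
  have heq := Set.eq_of_subset_of_ncard_le (s := {u | HasEdge G u v}) (fun u => hsub u v)
    (h𝒢.inDegree_eq hH hG v).le
  rw [mem_edges, mem_edges]
  exact Set.ext_iff.1 heq u

end

/-! ### Passes through the loop -/

section

variable {β : Type*} [DecidableEq β] {s : Finset β}

theorem unif_ne_zero {b : β} : unif s b ≠ 0 ↔ b ∈ s := by
  simp [unif]

variable [Fintype β]

theorem sum_unif_mul (f : β → ℝ≥0∞) : ∑ b, unif s b * f b = (s.card : ℝ≥0∞)⁻¹ * ∑ b ∈ s, f b := by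
  simp only [unif, ite_mul, zero_mul, Finset.sum_ite_mem, Finset.univ_inter, Finset.mul_sum]

theorem sum_unif_le_one : ∑ b, unif s b ≤ 1 := by
  simp only [unif, Finset.sum_ite_mem, Finset.univ_inter, Finset.sum_const, nsmul_eq_mul]
  exact ENNReal.mul_inv_le_one _

theorem sum_unif (hs : s.Nonempty) : ∑ b, unif s b = 1 := by
  simp only [unif, Finset.sum_ite_mem, Finset.univ_inter, Finset.sum_const, nsmul_eq_mul]
  exact ENNReal.mul_inv_cancel (by simpa using hs.ne_empty) (by simp)

end

section

variable {V X : Type*} [Fintype V] [EditableGraph X V] {𝒢 : Set X} {G H : X} {p : Option V}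
  {w₀ w : V} {k : ℕ}

open Classical in
/-- The probability that one pass through the loop, entered with current graph `G`, `W_{n-1} = p`
and `W_n = w`, draws `W_{n+1} = x.1` and `W_{n+2} = x.2`. -/
noncomputable def passProb (𝒢 : Set X) (G : X) (p : Option V) (w : V) (x : V × V) : ℝ≥0∞ :=
  unif (inNbrsAvoid 𝒢 G p w) x.1 * unif (nonOutNbrs 𝒢 G x.1) x.2

theorem passProb_ne_zero {x : V × V} :
    passProb 𝒢 G p w x ≠ 0 ↔ x.1 ∈ inNbrsAvoid 𝒢 G p w ∧ x.2 ∈ nonOutNbrs 𝒢 G x.1 := by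
  simp only [passProb, mul_ne_zero_iff, unif_ne_zero]

theorem sum_passProb_le_one : ∑ x, passProb 𝒢 G p w x ≤ 1 := by
  classical
  simp only [passProb, Fintype.sum_prod_type, ← Finset.mul_sum]
  calc _ ≤ ∑ a, unif (inNbrsAvoid 𝒢 G p w) a :=
        Finset.sum_le_sum fun a _ => mul_le_of_le_one_right' sum_unif_le_one
    _ ≤ 1 := sum_unif_le_one

open Classical in
theorem exitProb_succ : exitProb 𝒢 w₀ (k + 1) G p w H = ∑ x, passProb 𝒢 G p w x *
    if x.2 = w₀ then if k = 0 ∧ swapEdge G x.1 w x.2 = H then 1 else 0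
    else exitProb 𝒢 w₀ k (swapEdge G x.1 w x.2) (some x.1) x.2 H := by
  rw [Fintype.sum_prod_type]
  rfl

theorem exitProb_succ_ne_zero : exitProb 𝒢 w₀ (k + 1) G p w H ≠ 0 ↔
    ∃ a ∈ inNbrsAvoid 𝒢 G p w, ∃ b ∈ nonOutNbrs 𝒢 G a,
      b = w₀ ∧ k = 0 ∧ swapEdge G a w b = H ∨
      b ≠ w₀ ∧ exitProb 𝒢 w₀ k (swapEdge G a w b) (some a) b H ≠ 0 := by
  classical
  rw [exitProb_succ, ← pos_iff_ne_zero, Finset.sum_pos_iff]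
  simp only [Finset.mem_univ, true_and, Prod.exists, pos_iff_ne_zero, mul_ne_zero_iff,
    passProb_ne_zero, and_assoc]
  refine exists_congr fun a =>
    exists_and_left.trans (and_congr_right' (exists_congr fun b => and_congr_right' ?_))
  by_cases hb : b = w₀ <;> simp [hb]

/-- The situations in which an iteration started at `w₀` can enter the loop body: `G` is the
current graph, `p` stands for `W_{n-1}`, and `w` for `W_n`. -/
inductive IsLoopState [GraphKind X] (𝒢 : Set X) (w₀ : V) : X → Option V → V → Prop
  | start {G : X} (hG : G ∈ 𝒢) (hw : w₀ ∈ startSet 𝒢 G) : IsLoopState 𝒢 w₀ G none w₀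
  | pass {G : X} {a w : V} (hG : IsIntermediate 𝒢 w₀ w G) (ha : a ∈ inNbrs 𝒢 G w) (hw : w ≠ w₀) :
      IsLoopState 𝒢 w₀ G (some a) w

variable [GraphKind X]

/-- Comparing degrees with `H`, the tail `c` of a surplus edge `cw` misses an edge `cb` of `H`, and
replacing `cw` by `cb` makes an edge into `b` surplus, unless `b = w₀`. -/
theorem IsIntermediate.exists_exitProb_ne_zero (h𝒢 : IsDegreeClass 𝒢) (hH : H ∈ 𝒢)
    (hG : IsIntermediate 𝒢 w₀ w G) {c : V} (hc : HasEdge G c w) (hc' : ¬ HasEdge H c w)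
    (hp : some c ≠ p) :
    ∃ G' ∈ 𝒢, (∃ k, exitProb 𝒢 w₀ k G p w G' ≠ 0) ∧ excess G' H < excess G H := by
  induction hn : excess G H using Nat.strong_induction_on generalizing G p w c with
  | _ n ih =>
  obtain ⟨b, hb, hb'⟩ := hG.exists_hasEdge_tail hH hc hc'
  have hcN : c ∈ inNbrs 𝒢 G w :=
    mem_inNbrs.2 ⟨hc, hG.not_known_of_not_iff hH fun h => hc' (h.1 hc)⟩
  have hbM : b ∈ nonOutNbrs 𝒢 G c :=
    mem_nonOutNbrs.2 ⟨hb', hG.not_known_of_not_iff hH fun h => hb' (h.2 hb)⟩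
  have hcp : c ∈ inNbrsAvoid 𝒢 G p w := mem_inNbrsAvoid.2 ⟨hcN, hp⟩
  have hlt : excess (swapEdge G c w b) H < n := hn ▸ excess_swapEdge_lt hc hc' hb
  have hG' := hG.swapEdge hcN hbM
  by_cases hbw : b = w₀
  · have hmem : swapEdge G c w b ∈ 𝒢 := by
      subst hbw
      exact h𝒢.isIntermediate_self_iff.1 hG'
    exact ⟨_, hmem,
      ⟨1, exitProb_succ_ne_zero.2 ⟨c, hcp, b, hbM, Or.inl ⟨hbw, rfl, rfl⟩⟩⟩, hlt⟩
  · obtain ⟨c', hc₁, hc₂⟩ := hG'.exists_hasEdge_head hH hbw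
    have hcc : some c' ≠ some c := fun h => hc₂ (Option.some_injective V h ▸ hb)
    obtain ⟨K, hK, ⟨k, hk⟩, hKlt⟩ := ih _ hlt hG' hc₁ hc₂ hcc rfl
    exact ⟨K, hK, ⟨k + 1, exitProb_succ_ne_zero.2 ⟨c, hcp, b, hbM, Or.inr ⟨hbw, hk⟩⟩⟩,
      hKlt.trans hlt⟩

theorem exists_iterProb_ne_zero (h𝒢 : IsDegreeClass 𝒢) (hG : G ∈ 𝒢) (hH : H ∈ 𝒢) (hne : G ≠ H) :
    ∃ G' ∈ 𝒢, iterProb 𝒢 G G' ≠ 0 ∧ excess G' H < excess G H := by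
  classical
  obtain ⟨c, w, hc, hc'⟩ := h𝒢.exists_hasEdge_of_ne hG hH hne
  have hGw : IsIntermediate 𝒢 w w G := h𝒢.isIntermediate_self_iff.2 hG
  have hw : w ∈ startSet 𝒢 G :=
    mem_startSet.2 ⟨c, mem_inNbrs.2 ⟨hc, hGw.not_known_of_not_iff hH fun h => hc' (h.1 hc)⟩⟩
  obtain ⟨G', hG', ⟨k, hk⟩, hlt⟩ :=
    hGw.exists_exitProb_ne_zero h𝒢 hH hc hc' (Option.some_ne_none c)
  have htsum : ∑' k, exitProb 𝒢 w k G none w G' ≠ 0 := fun h => hk (ENNReal.tsum_eq_zero.1 h k)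
  refine ⟨G', hG', ?_, hlt⟩
  rw [iterProb, if_pos ⟨w, hw⟩, ← pos_iff_ne_zero, Finset.sum_pos_iff]
  exact ⟨w, Finset.mem_univ w, pos_iff_ne_zero.2 (mul_ne_zero (unif_ne_zero.2 hw) htsum)⟩

namespace IsLoopState

theorem isIntermediate (h𝒢 : IsDegreeClass 𝒢) (hs : IsLoopState 𝒢 w₀ G p w) :
    IsIntermediate 𝒢 w₀ w G := by
  cases hs with
  | start hG _ => exact h𝒢.isIntermediate_self_iff.2 hG
  | pass hG _ _ => exact hG

theorem swapEdge_mem (h𝒢 : IsDegreeClass 𝒢) (hs : IsLoopState 𝒢 w₀ G p w) {a : V}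
    (ha : a ∈ inNbrsAvoid 𝒢 G p w) (hb : w₀ ∈ nonOutNbrs 𝒢 G a) : swapEdge G a w w₀ ∈ 𝒢 :=
  h𝒢.isIntermediate_self_iff.1 ((hs.isIntermediate h𝒢).swapEdge (mem_inNbrsAvoid.1 ha).1 hb)

protected theorem swapEdge (h𝒢 : IsDegreeClass 𝒢) (hs : IsLoopState 𝒢 w₀ G p w) {a b : V}
    (ha : a ∈ inNbrsAvoid 𝒢 G p w) (hb : b ∈ nonOutNbrs 𝒢 G a) (hbw : b ≠ w₀) :
    IsLoopState 𝒢 w₀ (swapEdge G a w b) (some a) b :=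
  .pass ((hs.isIntermediate h𝒢).swapEdge (mem_inNbrsAvoid.1 ha).1 hb) (mem_inNbrs_swapEdge hb) hbw

/-- The iteration is guided out of the loop by a member of `𝒢` that lacks some edge into `w`. After
the first pass that edge must not be the one just added, so the guide is chosen to contain the
latter. -/
theorem exists_exitProb_ne_zero (h𝒢 : IsDegreeClass 𝒢) (hs : IsLoopState 𝒢 w₀ G p w) :
    ∃ k, ∃ H ∈ 𝒢, exitProb 𝒢 w₀ k G p w H ≠ 0 := by
  obtain ⟨c, H, hH, hc, hc', hp⟩ :
      ∃ c, ∃ H ∈ 𝒢, HasEdge G c w ∧ ¬ HasEdge H c w ∧ some c ≠ p := by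
    cases hs with
    | start hG hw =>
      obtain ⟨c, hc⟩ := mem_startSet.1 hw
      rw [mem_inNbrs] at hc
      obtain ⟨H, hH, hcH⟩ := exists_not_hasEdge_of_not_known hc.2
      exact ⟨c, H, hH, hc.1, hcH, Option.some_ne_none c⟩
    | pass hG ha hw =>
      obtain ⟨H, hH, haH⟩ := exists_hasEdge_of_not_known (mem_inNbrs.1 ha).2
      obtain ⟨c, hc, hcH⟩ := hG.exists_hasEdge_head hH hw
      exact ⟨c, H, hH, hc, hcH, fun h => hcH (Option.some_injective V h ▸ haH)⟩
  obtain ⟨G', hG', ⟨k, hk⟩, -⟩ :=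
    (hs.isIntermediate h𝒢).exists_exitProb_ne_zero h𝒢 hH hc hc' hp
  exact ⟨k, G', hG', hk⟩

theorem sum_passProb (h𝒢 : IsDegreeClass 𝒢) (hs : IsLoopState 𝒢 w₀ G p w) :
    ∑ x, passProb 𝒢 G p w x = 1 := by
  classical
  have hne : (inNbrsAvoid 𝒢 G p w).Nonempty := by
    obtain ⟨k, H, -, hk⟩ := hs.exists_exitProb_ne_zero h𝒢
    cases k with
    | zero => exact absurd rfl hk
    | succ k =>
      obtain ⟨a, ha, -⟩ := exitProb_succ_ne_zero.1 hk
      exact ⟨a, ha⟩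
  simp only [passProb, Fintype.sum_prod_type, ← Finset.mul_sum]
  rw [← sum_unif hne]
  refine Finset.sum_congr rfl fun a _ => ?_
  by_cases ha : a ∈ inNbrsAvoid 𝒢 G p w
  · rw [sum_unif ((hs.isIntermediate h𝒢).nonOutNbrs_nonempty (mem_inNbrsAvoid.1 ha).1), mul_one]
  · simp [unif, ha]

end IsLoopState

end

/-! ### Reversibility -/

open Matrix

theorem isSymm_mul_pow_mul {ι R : Type*} [Fintype ι] [DecidableEq ι] [CommSemiring R]
    {A T : Matrix ι ι R} (hA : A.IsSymm) (hT : T.IsSymm) (k : ℕ) : ((A * T) ^ k * A).IsSymm := by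
  rw [IsSymm, transpose_mul, transpose_pow, transpose_mul, hA.eq, hT.eq, mul_pow_mul]

section

variable {V X : Type*} [Fintype V] [EditableGraph X V] {𝒢 : Set X} {G H K : X} {p : Option V}
  {w₀ w : V} {k : ℕ}

theorem IsLoopState.card_inNbrsAvoid [GraphKind X] (h𝒢 : IsDegreeClass 𝒢)
    (hs : IsLoopState 𝒢 w₀ G p w) (hK : K ∈ 𝒢) :
    (inNbrsAvoid 𝒢 G p w).card = (inNbrs 𝒢 K w).card := by
  classical
  cases hs with
  | start hG _ =>
    rw [← h𝒢.card_inNbrs_eq hG hK w₀]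
    exact congrArg _ (Finset.filter_true_of_mem fun a _ => Option.some_ne_none a)
  | @pass a _ hG ha hw =>
    have hcard := hG.card_inNbrs_add hK w
    rw [Finsupp.single_eq_same, Finsupp.single_eq_of_ne hw, add_zero] at hcard
    have herase : inNbrsAvoid 𝒢 G (some a) w = (inNbrs 𝒢 G w).erase a := by
      ext v
      simp [and_comm]
    rw [herase, Finset.card_erase_of_mem ha, hcard, Nat.add_sub_cancel]

open Classical in
/-- The second half of a pass: from `(a, G, w)`, where `a` is the tail of the edge `aw` that is
about to be removed from `G`, to `(a, swapEdge G a w b, b)`. -/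
noncomputable def swapMatrix (𝒢 : Set X) : Matrix (V × X × V) (V × X × V) ℝ≥0∞ :=
  .of fun x y => if x.1 ∈ inNbrs 𝒢 x.2.1 x.2.2 ∧ y.1 = x.1 ∧
    y.2.1 = swapEdge x.2.1 x.1 x.2.2 y.2.2 then unif (nonOutNbrs 𝒢 x.2.1 x.1) y.2.2 else 0

open Classical in
/-- The first half of a pass other than the first one: from `(a, G, w)` to `(a', G, w)` with
`a' ≠ a`. By `IsLoopState.card_inNbrsAvoid` the number of choices for `a'` can be read off from any
member `K` of the class. -/
noncomputable def turnMatrix (𝒢 : Set X) (w₀ : V) (K : X) :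
    Matrix (V × X × V) (V × X × V) ℝ≥0∞ :=
  .of fun x y => if y.1 ≠ x.1 ∧ y.2 = x.2 ∧ x.2.2 ≠ w₀ then
    ((inNbrs 𝒢 K x.2.2).card : ℝ≥0∞)⁻¹ else 0

theorem isSymm_turnMatrix : (turnMatrix 𝒢 w₀ K).IsSymm := by
  refine IsSymm.ext fun x y => ?_
  simp only [turnMatrix, of_apply]
  grind

theorem isSymm_swapMatrix [GraphKind X] : (swapMatrix 𝒢).IsSymm := by
  classical
  have key {a w b : V} {G : X} (ha : a ∈ inNbrs 𝒢 G w) (hb : b ∈ nonOutNbrs 𝒢 G a) :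
      swapMatrix 𝒢 (a, swapEdge G a w b, b) (a, G, w) =
        swapMatrix 𝒢 (a, G, w) (a, swapEdge G a w b, b) := by
    simp only [swapMatrix, of_apply, unif, ha, hb, mem_inNbrs_swapEdge hb,
      mem_nonOutNbrs_swapEdge ha hb, card_nonOutNbrs_swapEdge ha hb,
      swapEdge_swapEdge_of_mem ha hb, and_self, if_true]
  have hne {x y : V × X × V} (h : swapMatrix 𝒢 x y ≠ 0) : swapMatrix 𝒢 y x = swapMatrix 𝒢 x y := by
    obtain ⟨a, G, w⟩ := x
    obtain ⟨a', G', b⟩ := y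
    simp only [swapMatrix, of_apply, ne_eq, ite_eq_right_iff, not_forall] at h
    obtain ⟨⟨ha, rfl, rfl⟩, hb⟩ := h
    exact key ha (unif_ne_zero.1 hb)
  refine IsSymm.ext fun x y => ?_
  by_cases hxy : swapMatrix 𝒢 x y = 0
  · by_contra hyx
    exact hyx (hne fun h => hyx (h.trans hxy.symm)).symm
  · exact hne hxy

variable [Fintype X]

open Classical in
theorem swapMatrix_mulVec (f : V × X × V → ℝ≥0∞) (a : V) (G : X) (w : V) :
    (swapMatrix 𝒢 *ᵥ f) (a, G, w) = if a ∈ inNbrs 𝒢 G w then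
      ∑ b, unif (nonOutNbrs 𝒢 G a) b * f (a, swapEdge G a w b, b) else 0 := by
  simp only [mulVec, dotProduct, swapMatrix, of_apply, Fintype.sum_prod_type]
  split_ifs with ha
  · rw [Finset.sum_eq_single_of_mem a (Finset.mem_univ a) fun a' _ h => by simp [h],
      Finset.sum_comm]
    refine Finset.sum_congr rfl fun b _ => ?_
    simp [ha]
  · simp [ha]

open Classical in
theorem turnMatrix_mulVec (f : V × X × V → ℝ≥0∞) (a : V) (G : X) (w : V) :
    (turnMatrix 𝒢 w₀ K *ᵥ f) (a, G, w) = if w = w₀ then 0 else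
      ((inNbrs 𝒢 K w).card : ℝ≥0∞)⁻¹ * ∑ a' with a' ≠ a, f (a', G, w) := by
  simp only [mulVec, dotProduct, turnMatrix, of_apply]
  rw [Fintype.sum_prod_type]
  split_ifs with hw
  · simp [hw]
  · rw [Finset.mul_sum, Finset.sum_filter]
    refine Finset.sum_congr rfl fun a' _ => ?_
    rw [Finset.sum_eq_single_of_mem (G, w) (Finset.mem_univ _) fun y _ h => by simp [h]]
    simp [hw]

variable [GraphKind X]

open Classical in
theorem IsLoopState.sum_passProb_mul (h𝒢 : IsDegreeClass 𝒢) (hs : IsLoopState 𝒢 w₀ G p w)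
    (hK : K ∈ 𝒢) (f : V × X × V → ℝ≥0∞) :
    ∑ x, passProb 𝒢 G p w x * f (x.1, swapEdge G x.1 w x.2, x.2) =
      ((inNbrs 𝒢 K w).card : ℝ≥0∞)⁻¹ * ∑ a with some a ≠ p, (swapMatrix 𝒢 *ᵥ f) (a, G, w) := by
  have hfilter : inNbrsAvoid 𝒢 G p w = ({a | some a ≠ p} : Finset V).filter (· ∈ inNbrs 𝒢 G w) := by
    ext a
    simp [and_comm]
  simp only [Fintype.sum_prod_type, passProb, mul_assoc, ← Finset.mul_sum, swapMatrix_mulVec]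
  rw [sum_unif_mul, hs.card_inNbrsAvoid h𝒢 hK, hfilter, Finset.sum_filter]

open Classical in
theorem IsLoopState.exitProb_eq (h𝒢 : IsDegreeClass 𝒢) (hK : K ∈ 𝒢)
    (hs : IsLoopState 𝒢 w₀ G p w) :
    exitProb 𝒢 w₀ (k + 1) G p w H = ((inNbrs 𝒢 K w).card : ℝ≥0∞)⁻¹ * ∑ a with some a ≠ p,
      (((swapMatrix 𝒢 * turnMatrix 𝒢 w₀ K) ^ k * swapMatrix 𝒢) *ᵥ
        fun x => if x.2 = (H, w₀) then 1 else 0) (a, G, w) := by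
  induction k generalizing G p w with
  | zero =>
    rw [pow_zero, one_mul, ← hs.sum_passProb_mul h𝒢 hK, exitProb_succ]
    refine Finset.sum_congr rfl fun x _ => congrArg _ ?_
    by_cases hb : x.2 = w₀ <;> simp [hb, exitProb]
  | succ k ih =>
    rw [pow_succ', mul_assoc, mul_assoc, ← mulVec_mulVec, ← mulVec_mulVec,
      ← hs.sum_passProb_mul h𝒢 hK, exitProb_succ]
    refine Finset.sum_congr rfl fun x _ => ?_
    by_cases hx : passProb 𝒢 G p w x = 0
    · rw [hx, zero_mul, zero_mul]
    obtain ⟨ha, hb⟩ := passProb_ne_zero.1 hx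
    rw [turnMatrix_mulVec]
    split_ifs with hw₀ hk
    · simp at hk
    · rfl
    · rw [ih (hs.swapEdge h𝒢 ha hb hw₀)]
      simp

omit [Fintype X] in
theorem exitProb_comm (h𝒢 : IsDegreeClass 𝒢) (hG : G ∈ 𝒢) (hH : H ∈ 𝒢)
    (hw : w₀ ∈ startSet 𝒢 G) (k : ℕ) :
    exitProb 𝒢 w₀ k G none w₀ H = exitProb 𝒢 w₀ k H none w₀ G := by
  classical
  have : Finite X := finite_graph
  have := Fintype.ofFinite X
  have hsH : IsLoopState 𝒢 w₀ H none w₀ := .start hH (h𝒢.startSet_eq hG hH ▸ hw)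
  cases k with
  | zero => rfl
  | succ k =>
    have hsymm : ((swapMatrix 𝒢 * turnMatrix 𝒢 w₀ G) ^ k * swapMatrix 𝒢).IsSymm :=
      isSymm_mul_pow_mul isSymm_swapMatrix isSymm_turnMatrix k
    rw [(IsLoopState.start hG hw).exitProb_eq h𝒢 hG, hsH.exitProb_eq h𝒢 hG]
    simp only [mulVec, dotProduct, Fintype.sum_prod_type (α₁ := V), mul_ite, mul_one, mul_zero,
      Finset.sum_ite_eq', Finset.mem_univ, if_true, ne_eq, reduceCtorEq, not_false_eq_true,
      Finset.filter_true]
    rw [Finset.sum_comm]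
    simp only [hsymm.apply]

omit [Fintype X] in
theorem iterProb_comm (h𝒢 : IsDegreeClass 𝒢) (hG : G ∈ 𝒢) (hH : H ∈ 𝒢) :
    iterProb 𝒢 G H = iterProb 𝒢 H G := by
  classical
  rw [iterProb, iterProb, h𝒢.startSet_eq hH hG, eq_comm (a := G)]
  congr 1
  refine Finset.sum_congr rfl fun w₀ _ => ?_
  by_cases hw : w₀ ∈ startSet 𝒢 G
  · simp only [exitProb_comm h𝒢 hG hH hw]
  · rw [not_ne_iff.1 (mt unif_ne_zero.1 hw), zero_mul, zero_mul]

end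

/-! ### Termination -/

theorem eq_of_sum_mul_le {ι : Type*} [Fintype ι] {K c : ι → ℝ≥0∞} {m : ℝ≥0∞} (hm : m ≠ ∞)
    (hK : ∑ i, K i = 1) (hc : ∀ i, K i ≠ 0 → m ≤ c i) (h : ∑ i, K i * c i ≤ m) {i : ι}
    (hi : K i ≠ 0) : c i = m := by
  have hmean : m + ∑ j, K j * (c j - m) = ∑ j, K j * c j := by
    nth_rw 1 [← one_mul m]
    rw [← hK, Finset.sum_mul, ← Finset.sum_add_distrib]
    refine Finset.sum_congr rfl fun j _ => ?_
    by_cases hj : K j = 0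
    · simp [hj]
    · rw [← mul_add, add_tsub_cancel_of_le (hc j hj)]
  have hzero : ∑ j, K j * (c j - m) = 0 := by
    rw [← hmean] at h
    exact le_zero_iff.1 ((ENNReal.add_le_add_iff_left hm).1 (h.trans_eq (add_zero m).symm))
  have hprod : K i * (c i - m) = 0 := Finset.sum_eq_zero_iff.1 hzero i (Finset.mem_univ i)
  exact (tsub_eq_zero_iff_le.1 ((mul_eq_zero.1 hprod).resolve_left hi)).antisymm (hc i hi)

section

variable {V X : Type*} [Fintype V] [EditableGraph X V] {𝒢 : Set X} {G : X} {p : Option V}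
  {w₀ w : V}

open Classical in
theorem tsum_ite_coe_eq_one (hG : G ∈ 𝒢) : ∑' H : 𝒢, (if G = H then 1 else 0 : ℝ≥0∞) = 1 := by
  rw [tsum_eq_single ⟨G, hG⟩ fun H hH => if_neg fun h => hH (Subtype.ext h.symm), if_pos rfl]

open Classical in
theorem tsum_ite_coe_le_one : ∑' H : 𝒢, (if G = H then 1 else 0 : ℝ≥0∞) ≤ 1 := by
  by_cases hG : G ∈ 𝒢
  · exact (tsum_ite_coe_eq_one hG).le
  · simp [show ∀ H : 𝒢, G ≠ H from fun H h => hG (h ▸ H.2)]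

/-- The probability that the loop, entered in the situation `G`, `p`, `w` of `exitProb`, stops and
returns a graph in `𝒢`. -/
noncomputable def stopProb (𝒢 : Set X) (w₀ : V) (G : X) (p : Option V) (w : V) : ℝ≥0∞ :=
  ∑' k, ∑' H : 𝒢, exitProb 𝒢 w₀ k G p w H

open Classical in
theorem tsum_exitProb_succ (k : ℕ) : ∑' H : 𝒢, exitProb 𝒢 w₀ (k + 1) G p w H =
    ∑ x, passProb 𝒢 G p w x * if x.2 = w₀ then
      if k = 0 then ∑' H : 𝒢, if swapEdge G x.1 w x.2 = H then 1 else 0 else 0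
    else ∑' H : 𝒢, exitProb 𝒢 w₀ k (swapEdge G x.1 w x.2) (some x.1) x.2 H := by
  simp only [exitProb_succ]
  rw [Summable.tsum_finsetSum fun _ _ => ENNReal.summable]
  refine Finset.sum_congr rfl fun x _ => ?_
  rw [ENNReal.tsum_mul_left]
  by_cases hk : k = 0 <;> split_ifs <;> simp [hk]

open Classical in
theorem stopProb_eq : stopProb 𝒢 w₀ G p w = ∑ x, passProb 𝒢 G p w x * if x.2 = w₀ then
    ∑' H : 𝒢, if swapEdge G x.1 w x.2 = H then 1 else 0
    else stopProb 𝒢 w₀ (swapEdge G x.1 w x.2) (some x.1) x.2 := by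
  have hzero : ∑' H : 𝒢, exitProb 𝒢 w₀ 0 G p w H = 0 := ENNReal.tsum_eq_zero.2 fun _ => rfl
  rw [stopProb, tsum_eq_zero_add' ENNReal.summable, hzero, zero_add]
  simp only [tsum_exitProb_succ]
  rw [Summable.tsum_finsetSum fun _ _ => ENNReal.summable]
  refine Finset.sum_congr rfl fun x _ => ?_
  rw [ENNReal.tsum_mul_left]
  split_ifs with hb
  · rw [tsum_ite_eq 0]
  · rfl

theorem sum_range_exitProb_le_one (n : ℕ) :
    ∑ k ∈ Finset.range n, ∑' H : 𝒢, exitProb 𝒢 w₀ k G p w H ≤ 1 := by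
  classical
  induction n generalizing G p w with
  | zero => simp
  | succ n ih =>
    have hzero : ∑' H : 𝒢, exitProb 𝒢 w₀ 0 G p w H = 0 := ENNReal.tsum_eq_zero.2 fun _ => rfl
    rw [Finset.sum_range_succ', hzero, add_zero]
    simp only [tsum_exitProb_succ]
    rw [Finset.sum_comm]
    simp only [← Finset.mul_sum]
    refine le_trans (Finset.sum_le_sum fun x _ => mul_le_of_le_one_right' ?_) sum_passProb_le_one
    split_ifs with hb
    · rw [Finset.sum_ite_eq']
      split_ifs
      exacts [tsum_ite_coe_le_one, zero_le_one]
    · exact ih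

theorem stopProb_le_one : stopProb 𝒢 w₀ G p w ≤ 1 :=
  ENNReal.tsum_le_of_sum_range_le sum_range_exitProb_le_one

variable [GraphKind X]

/-- By `stopProb_eq`, a minimum of `stopProb` is propagated along the passes, and a pass that ends
the loop would make it equal to `1`. -/
theorem IsLoopState.exitProb_eq_zero_of_forall_le (h𝒢 : IsDegreeClass 𝒢) {m : ℝ≥0∞} (hm : m < 1)
    (hmin : ∀ {G p w}, IsLoopState 𝒢 w₀ G p w → m ≤ stopProb 𝒢 w₀ G p w)
    (hs : IsLoopState 𝒢 w₀ G p w) (h : stopProb 𝒢 w₀ G p w ≤ m) (k : ℕ) (H : X) :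
    exitProb 𝒢 w₀ k G p w H = 0 := by
  classical
  induction k generalizing G p w with
  | zero => rfl
  | succ k ih =>
    by_contra hk
    obtain ⟨a, ha, b, hb, hexit⟩ := exitProb_succ_ne_zero.1 hk
    rw [stopProb_eq] at h
    have hval := eq_of_sum_mul_le hm.ne_top (hs.sum_passProb h𝒢) ?_ h
      (passProb_ne_zero (x := (a, b)).2 ⟨ha, hb⟩)
    · rcases hexit with ⟨rfl, -, -⟩ | ⟨hbw, hexit⟩
      · rw [if_pos rfl, tsum_ite_coe_eq_one (hs.swapEdge_mem h𝒢 ha hb)] at hval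
        exact hm.ne' hval
      · rw [if_neg hbw] at hval
        exact hexit (ih (hs.swapEdge h𝒢 ha hb hbw) hval.le)
    · rintro ⟨a, b⟩ hx
      obtain ⟨ha, hb⟩ := passProb_ne_zero.1 hx
      split_ifs with hbw
      · obtain rfl : b = w₀ := hbw
        exact hm.le.trans_eq (tsum_ite_coe_eq_one (hs.swapEdge_mem h𝒢 ha hb)).symm
      · exact hmin (hs.swapEdge h𝒢 ha hb hbw)

theorem IsLoopState.stopProb_eq_one (h𝒢 : IsDegreeClass 𝒢) (hs : IsLoopState 𝒢 w₀ G p w) :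
    stopProb 𝒢 w₀ G p w = 1 := by
  have : Finite X := finite_graph
  refine stopProb_le_one.antisymm ?_
  obtain ⟨⟨G₁, p₁, w₁⟩, hs₁, hmin⟩ := Set.exists_min_image
    {x : X × Option V × V | IsLoopState 𝒢 w₀ x.1 x.2.1 x.2.2}
    (fun x => stopProb 𝒢 w₀ x.1 x.2.1 x.2.2) (Set.toFinite _) ⟨(G, p, w), hs⟩
  refine le_trans ?_ (hmin (G, p, w) hs)
  by_contra! hlt
  obtain ⟨k, H, -, hk⟩ := hs₁.exists_exitProb_ne_zero h𝒢
  exact hk (hs₁.exitProb_eq_zero_of_forall_le h𝒢 hlt (fun {G p w} h => hmin (G, p, w) h) le_rfl k H)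

theorem sum_iterProb [Fintype 𝒢] (h𝒢 : IsDegreeClass 𝒢) (hG : G ∈ 𝒢) :
    ∑ H : 𝒢, iterProb 𝒢 G H = 1 := by
  classical
  by_cases hne : (startSet 𝒢 G).Nonempty
  · simp only [iterProb, if_pos hne]
    rw [Finset.sum_comm, ← sum_unif hne]
    refine Finset.sum_congr rfl fun w₀ _ => ?_
    rw [← Finset.mul_sum]
    by_cases hw : w₀ ∈ startSet 𝒢 G
    · have htotal : ∑ H : 𝒢, ∑' k, exitProb 𝒢 w₀ k G none w₀ H = 1 := by
        rw [← tsum_fintype (L := .unconditional _), ENNReal.tsum_comm]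
        exact (IsLoopState.start hG hw).stopProb_eq_one h𝒢
      rw [htotal, mul_one]
    · rw [not_ne_iff.1 (mt unif_ne_zero.1 hw), zero_mul]
  · simp only [iterProb, if_neg hne]
    rw [← tsum_fintype (L := .unconditional _), tsum_ite_coe_eq_one hG]

theorem iterProb_ne_top (h𝒢 : IsDegreeClass 𝒢) (hG : G ∈ 𝒢) (H : 𝒢) : iterProb 𝒢 G H ≠ ∞ := by
  have : Finite X := finite_graph
  have := Fintype.ofFinite 𝒢
  exact ENNReal.sum_ne_top.1 ((sum_iterProb h𝒢 hG).trans_ne ENNReal.one_ne_top) H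
    (Finset.mem_univ H)

/-! ### Ergodicity -/

theorem IsDegreeClass.isErgodicChain [Fintype 𝒢] [DecidableEq 𝒢] (h𝒢 : IsDegreeClass 𝒢) :
    IsErgodicChain (transition 𝒢) (uniformDist 𝒢) := by
  have : Nonempty 𝒢 := h𝒢.nonempty.to_subtype
  have hstoch : transition 𝒢 ∈ Matrix.rowStochastic ℝ 𝒢 := by
    refine Matrix.mem_rowStochastic_iff_sum.2 ⟨fun G H => ENNReal.toReal_nonneg, fun G => ?_⟩
    simp only [transition, Matrix.of_apply]
    rw [← ENNReal.toReal_sum fun H _ => iterProb_ne_top h𝒢 G.2 H, sum_iterProb h𝒢 G.2,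
      ENNReal.toReal_one]
  have hsymm : (transition 𝒢).IsSymm := Matrix.IsSymm.ext fun G H => by
    simp only [transition, Matrix.of_apply, iterProb_comm h𝒢 H.2 G.2]
  refine isErgodicChain_uniformDist hstoch hsymm fun G H =>
    exists_pow_pos_of_descent (P := transition 𝒢) (fun _ _ => ENNReal.toReal_nonneg)
      (fun G => excess (G : X) H) (fun G hne => ?_) G
  obtain ⟨G', hG', hpos, hlt⟩ := exists_iterProb_ne_zero h𝒢 G.2 H.2 (Subtype.coe_ne_coe.2 hne)
  exact ⟨⟨G', hG'⟩, ENNReal.toReal_pos hpos (iterProb_ne_top h𝒢 G.2 ⟨G', hG'⟩), hlt⟩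

end

end UGS

open Classical in
theorem proposition2 {V : Type*} [Fintype V] :
    (∀ (G₀ : Digraph V) (F : Set (V × V)),
      IsErgodicChain (UGS.transition (directedClass G₀ F)) (uniformDist (directedClass G₀ F))) ∧
    (∀ (G₀ : SimpleGraph V) (F : Set (Sym2 V)),
      IsErgodicChain (UGS.transition (undirectedClass G₀ F))
        (uniformDist (undirectedClass G₀ F))) := by
  refine ⟨fun G₀ F => UGS.IsDegreeClass.isErgodicChain ?_,
    fun G₀ F => UGS.IsDegreeClass.isErgodicChain ?_⟩
  · rw [UGS.directedClass_eq_degreeClass]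
    exact UGS.isDegreeClass_degreeClass G₀ F
  · rw [UGS.undirectedClass_eq_degreeClass]
    exact UGS.isDegreeClass_degreeClass G₀ F
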